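/- Let $\Theta\subset\mathbb{R}^d$ be compact, and for $\theta\in\Theta$ let $f_\theta:[0,\infty)^{\mathbb{N}}\to[0,\infty)$ be measurable, with $\theta\mapsto f_\theta(y)$ twice continuously differentiable on $\Theta$ for every $y$. Let $\theta^*$ lie in the interior of $\Theta$ and $k^*\in\mathbb{Z}$. Assume: 1. $\sup_{\theta\in\Theta} f_\theta(0)<\infty$, and $(\alpha^{(0)}_k)_{k\ge1}$ are non-negative reals with $\alpha^{(0)}:=\sum_{k\ge1}\alpha^{(0)}_k<1$, $\alpha^{(0)}_k=O(k^{-\gamma})$ for some $\gamma>3/2$, and $\sup_{\theta\in\Theta}|f_\theta(y)-f_\theta(y')|\le\sum_{k\ge1}\alpha^{(0)}_k|y_k-y'_k|$ (a sum in $[0,\infty]$) for all $y,y'\in[0,\infty)^{\mathbb{N}}$; 2. there is $\underline c>0$ with $f_\theta(y)\ge\underline c$ for all $\theta\in\Theta$ and all $y$; 3. $Y=(Y_t)_{t\in\mathbb{Z}}$ is a process with values in $\{0,1,2,\dots\}$ such that for every $t>k^*$, conditionally on $\sigma(Y_s,\,s\le t-1)$, $Y_t$ has the Poisson distribution with mean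 $\lambda_t=f_{\theta^*}(Y_{t-1},Y_{t-2},\dots)$; and for every $r\ge1$ there is $C_{r,0}>0$ with $\mathbb{E}\,Y_t^r\le C_{r,0}$ for all $t\le k^*$; 4. for all $\theta,\theta'\in\Theta$, if $f_\theta(Y_{t-1},Y_{t-2},\dots)=f_{\theta'}(Y_{t-1},Y_{t-2},\dots)$ a.s. for some $t>k^*$, then $\theta=\theta'$. Let $\tilde Y=(\tilde Y_t)_{t\in\mathbb{Z}}$ be the stationary regime, that is, a strictly stationary process with values in $\{0,1,2,\dots\}$ and finite moments of every order such that for every $t\in\mathbb{Z}$, conditionally on $\sigma(\tilde Y_s,\,s\le t-1)$, $\tilde Y_t$ has the Poisson distribution with mean $\tilde\lambda_t=f_{\theta^*}(\tilde Y_{t-1},\tilde Y_{t-2},\dots)$. Let $Y$ and $\tilde Y$ be defined on the same probability space and coupled through common Poisson processes: there are independent unit-rate Poisson processes $N_t(\cdot)$, $t>k^*$, with each $N_t$ independent of $\sigma(Y_s,\tilde Y_s,\ s\le t-1)$, such that almost surely $Y_t=N_t(\lambda_t)$ and $\tilde Y_t=N_t(\tilde\lambda_t)$ for all $t>k^*$.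 Then there is $C>0$ such that for all integers $\ell\ge1$, $$\mathbb{E}\,|Y_{k^*+\ell}-\tilde Y_{k^*+\ell}|\le C\,\inf_{1\le p\le\ell}\Big\{(\alpha^{(0)})^{\ell/p}+\sum_{k\ge p}\alpha^{(0)}_k\Big\},$$ where the infimum is over integers $p$ and the left-hand side is finite. Moreover the infimum on the right tends to $0$ as $\ell\to\infty$, and hence so does the left-hand side. -/

import Mathlib

open MeasureTheory ProbabilityTheory Filter Topology Asymptotics
open scoped NNReal ENNReal

namespace PoissonAR

/-- The `σ`-field `σ(X_s, s ≤ t)` generated by the whole past of an integer-valued process. -/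
abbrev pastSigma {Ω : Type*} (X : ℤ → Ω → ℕ) (t : ℤ) : MeasurableSpace Ω :=
  ⨆ s : ℤ, ⨆ _ : s ≤ t, MeasurableSpace.comap (X s) ⊤

/-- The sequence `(X_{t-1}, X_{t-2}, …)`; entry `j : ℕ` is `X_{t-1-j}`. -/
def lags {Ω : Type*} (X : ℤ → Ω → ℕ) (t : ℤ) (ω : Ω) : ℕ → ℝ≥0 :=
  fun j => (X (t - 1 - (j : ℤ)) ω : ℝ≥0)

/-- `X_t | σ(X_s, s ≤ t - 1) ∼ Poisson(g(X_{t-1}, X_{t-2}, …))`. -/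
def CondPoisson {Ω : Type*} [MeasurableSpace Ω] (μ : Measure Ω) (g : (ℕ → ℝ≥0) → ℝ≥0)
    (X : ℤ → Ω → ℕ) (t : ℤ) : Prop :=
  ∀ n : ℕ, μ⟦X t ⁻¹' {n} | pastSigma X (t - 1)⟧ =ᵐ[μ]
    fun ω => (poissonMeasure (g (lags X t ω))).real {n}

/-- The nonstationary model: an integer-valued process whose past up to time `k` is arbitrary, and
which is a Poisson autoregression with intensity function `g` at all times `t > k`. -/
structure IsPoissonARAfter {Ω : Type*} [MeasurableSpace Ω] (μ : Measure Ω)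
    (g : (ℕ → ℝ≥0) → ℝ≥0) (k : ℤ) (Y : ℤ → Ω → ℕ) : Prop where
  measurable : ∀ t, Measurable (Y t)
  condPoisson : ∀ t, k < t → CondPoisson μ g Y t

/-- The stationary regime: a strictly stationary process, with finite moments of every order, which
is a Poisson autoregression with intensity function `g` at all times `t ∈ ℤ`. -/
structure IsStationaryRegime {Ω : Type*} [MeasurableSpace Ω] (μ : Measure Ω)
    (g : (ℕ → ℝ≥0) → ℝ≥0) (Y : ℤ → Ω → ℕ) : Prop where
  measurable : ∀ t, Measurable (Y t)
  condPoisson : ∀ t, CondPoisson μ g Y t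
  stationary : ∀ h : ℤ, μ.map (fun ω (t : ℤ) => Y (t + h) ω) = μ.map (fun ω (t : ℤ) => Y t ω)
  moments : ∀ r : ℝ, 1 ≤ r → ∀ t, ∫⁻ ω, (Y t ω : ℝ≥0∞) ^ r ∂μ < ∞

/-- A Poisson process of unit intensity on `[0, ∞)`: nondecreasing right-continuous paths started
at `0`, independent increments, and increments over `[a, b]` with the `Poisson(b - a)` law. -/
structure IsUnitPoissonProcess {Ω : Type*} [MeasurableSpace Ω] (μ : Measure Ω)
    (N : ℝ≥0 → Ω → ℕ) : Prop where
  measurable : ∀ u, Measurable (N u)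
  zero : ∀ ω, N 0 ω = 0
  mono : ∀ ω, Monotone fun u => N u ω
  rightCts : ∀ ω u, ContinuousWithinAt (fun v => N v ω) (Set.Ici u) u
  increment : ∀ a b : ℝ≥0, a ≤ b →
    HasLaw (fun ω => N b ω - N a ω) (poissonMeasure (b - a)) μ
  indepIncrements : HasIndepIncrements N μ

/-- `Y` and `Y'` are driven, at all times `t > k`, by common independent unit-rate Poisson
processes `N t`: `Y_t = N_t(g(Y_{t-1}, …))` and `Y'_t = N_t(g(Y'_{t-1}, …))`, where `N t` is
independent of the joint past of `Y` and `Y'` strictly before time `t`. -/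
structure IsPoissonCoupling {Ω : Type*} [MeasurableSpace Ω] (μ : Measure Ω)
    (g : (ℕ → ℝ≥0) → ℝ≥0) (k : ℤ) (N : ℤ → ℝ≥0 → Ω → ℕ) (Y Y' : ℤ → Ω → ℕ) : Prop where
  poisson : ∀ t, k < t → IsUnitPoissonProcess μ (N t)
  indep : iIndepFun (fun (t : Set.Ioi k) (ω : Ω) (u : ℝ≥0) => N t u ω) μ
  indep_past : ∀ t, k < t →
    Indep (MeasurableSpace.comap (fun (ω : Ω) (u : ℝ≥0) => N t u ω) inferInstance)
      (pastSigma Y (t - 1) ⊔ pastSigma Y' (t - 1)) μ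
  eq_left : ∀ t, k < t → ∀ᵐ ω ∂μ, Y t ω = N t (g (lags Y t ω)) ω
  eq_right : ∀ t, k < t → ∀ᵐ ω ∂μ, Y' t ω = N t (g (lags Y' t ω)) ω

/-- The Lipschitz-type condition on `f`, with coefficients `α 1, α 2, …` (`α 0` plays no role; the
entry `y j` of a sequence is its `(j+1)`-st term, so it is weighted by `α (j + 1)`). The right-hand
side of the Lipschitz bound is a sum in `[0, ∞]`, and may be infinite. -/
structure LipschitzCond {d : ℕ} (Θ : Set (EuclideanSpace ℝ (Fin d)))
    (f : EuclideanSpace ℝ (Fin d) → (ℕ → ℝ≥0) → ℝ≥0) (α : ℕ → ℝ) : Prop where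
  bounded : ∃ M : ℝ≥0, ∀ θ ∈ Θ, f θ 0 ≤ M
  nonneg : ∀ k, 1 ≤ k → 0 ≤ α k
  summable : Summable fun j => α (j + 1)
  sum_lt_one : ∑' j, α (j + 1) < 1
  lipschitz : ∀ θ ∈ Θ, ∀ y y' : ℕ → ℝ≥0,
    ENNReal.ofReal |(f θ y : ℝ) - (f θ y' : ℝ)| ≤
      ∑' j, ENNReal.ofReal (α (j + 1) * |(y j : ℝ) - (y' j : ℝ)|)

/-- The intensity is bounded below by a positive constant, uniformly over `Θ`. -/
def LowerBoundCond {d : ℕ} (Θ : Set (EuclideanSpace ℝ (Fin d)))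
    (f : EuclideanSpace ℝ (Fin d) → (ℕ → ℝ≥0) → ℝ≥0) : Prop :=
  ∃ c : ℝ≥0, 0 < c ∧ ∀ θ ∈ Θ, ∀ y, c ≤ f θ y

/-- Identifiability along the process `Y` after time `k`. -/
def IdentifiabilityCond {Ω : Type*} [MeasurableSpace Ω] (μ : Measure Ω) {d : ℕ}
    (Θ : Set (EuclideanSpace ℝ (Fin d))) (f : EuclideanSpace ℝ (Fin d) → (ℕ → ℝ≥0) → ℝ≥0)
    (k : ℤ) (Y : ℤ → Ω → ℕ) : Prop :=
  ∀ θ ∈ Θ, ∀ θ' ∈ Θ,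
    (∃ t, k < t ∧ ∀ᵐ ω ∂μ, f θ (lags Y t ω) = f θ' (lags Y t ω)) → θ = θ'

/-- Moments of every order are bounded uniformly over the times `t ≤ k`. -/
def PastMomentCond {Ω : Type*} [MeasurableSpace Ω] (μ : Measure Ω) (k : ℤ)
    (Y : ℤ → Ω → ℕ) : Prop :=
  ∀ r : ℝ, 1 ≤ r → ∃ C : ℝ≥0, 0 < C ∧ ∀ t, t ≤ k → ∫⁻ ω, (Y t ω : ℝ≥0∞) ^ r ∂μ ≤ C

/-- `inf_{1 ≤ p ≤ ℓ} { a^{ℓ/p} + ∑_{k ≥ p} α_k }` with `a = ∑_{k ≥ 1} α_k`. -/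
noncomputable def rate (α : ℕ → ℝ) (ℓ : ℕ) : ℝ :=
  ⨅ p : Set.Icc 1 ℓ,
    ((∑' j, α (j + 1)) ^ ((ℓ : ℝ) / ((p : ℕ) : ℝ)) + ∑' j, α ((p : ℕ) + j))

end PoissonAR

/-! Write `u t` for the `L¹` distance of the two processes at time `t`. For `t > k` both read the
same unit-rate Poisson path, independent of their joint past, so `u t` is at most the mean distance
of the two intensities (`IsUnitPoissonProcess.lintegral_abs_sub_comp_le`). The Lipschitz condition
turns this into the recursion `u t ≤ ∑' j, α (j + 1) * u (t - 1 - j)` (`IsPoissonCoupling.gap_le`).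

Moments bound `u` by some `M` up to time `k`; since the weights have mass `a < 1`, the recursion
carries `M` to all later times (`le_of_le_tsum_past_of_le`). It then improves on `M`: lags within a
window of length about `p` gain a factor `a` every `p` steps, while older lags cost at most `M`
times the tail of `α`, a loss that accumulates geometrically to a factor `1 / (1 - a)`
(`le_of_le_tsum_past`). For the limit, `p` is fixed to make the tail small before `ℓ` grows
(`tendsto_rate`). -/

namespace PoissonAR

/-! ### The deterministic recursion and the rate. -/

/-- A nonnegative sequence dominated by a weighted sum of its past, with weights of total mass
less than one, decays at the rate given by any window length `p`. -/
lemma le_of_le_tsum_past {u : ℤ → ℝ} {M : ℝ} {β : ℕ → ℝ} {k : ℤ}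
    (hu0 : ∀ t, 0 ≤ u t) (huM : ∀ t, u t ≤ M) (hβ0 : ∀ j, 0 ≤ β j) (hβ : Summable β)
    (hβ1 : ∑' j, β j < 1)
    (hrec : ∀ t, k < t → u t ≤ ∑' j : ℕ, β j * u (t - 1 - j)) (p : ℕ) (ℓ : ℕ) :
    u (k + ℓ) ≤ M * ((∑' j, β j) ^ ((ℓ : ℝ) / ((p + 1 : ℕ) : ℝ)) +
      (∑' j, β (p + j)) / (1 - ∑' j, β j)) := by
  set a := ∑' j, β j with ha
  set S := ∑' j, β (p + j) with hS
  have ha0 : 0 ≤ a := tsum_nonneg hβ0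
  have hS0 : 0 ≤ S := tsum_nonneg fun j => hβ0 _
  have hM0 : 0 ≤ M := (hu0 0).trans (huM 0)
  have h1a : 0 < 1 - a := by linarith
  have hK0 : 0 ≤ S / (1 - a) := by positivity
  induction ℓ using Nat.strong_induction_on with
  | _ ℓ ih =>
  rcases Nat.eq_zero_or_pos ℓ with rfl | hℓ
  · refine (huM _).trans ?_
    -- The power is `1` here even if `a = 0`, as `0 ^ 0 = 1`.
    simp only [Nat.cast_zero, zero_div, Real.rpow_zero]
    nlinarith
  have hx0 : (0 : ℝ) ≤ (ℓ : ℝ) / ((p + 1 : ℕ) : ℝ) := by positivity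
  set A := a ^ ((ℓ : ℝ) / ((p + 1 : ℕ) : ℝ)) with hA
  have hA0 : 0 ≤ A := Real.rpow_nonneg ha0 _
  have hsum : Summable fun j : ℕ => β j * u (k + ℓ - 1 - j) :=
    .of_nonneg_of_le (fun j => mul_nonneg (hβ0 j) (hu0 _))
      (fun j => mul_le_mul_of_nonneg_left (huM _) (hβ0 j)) (hβ.mul_right M)
  -- Lags in the window satisfy `j + 1 ≤ p + 1`, so the extra factor `a` makes up for the exponent
  -- lost by going back `j + 1` steps. If this goes back beyond `k`, then `ℓ ≤ p + 1` and `M * a` is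
  -- already small enough.
  have hwin : ∀ j < p, a * u (k + ℓ - 1 - j) ≤ M * (A + a * (S / (1 - a))) := by
    intro j hj
    rcases Nat.lt_or_ge ℓ (j + 1) with h | h
    · have hle : a ≤ A := by
        have := Real.rpow_le_rpow_of_exponent_ge' (y := 1) ha0 hβ1.le hx0
          ((div_le_one (by positivity)).2 (by exact_mod_cast (by omega : ℓ ≤ p + 1)))
        rwa [Real.rpow_one] at this
      have := mul_le_mul_of_nonneg_left (huM (k + ℓ - 1 - j)) ha0
      have h2 : 0 ≤ M * (a * (S / (1 - a))) := by positivity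
      nlinarith
    · have hi := ih (ℓ - (j + 1)) (by omega)
      have hcast : k + ((ℓ - (j + 1) : ℕ) : ℤ) = k + ℓ - 1 - j := by
        push_cast [h]; ring
      rw [hcast] at hi
      have hpow : a * a ^ (((ℓ - (j + 1) : ℕ) : ℝ) / ((p + 1 : ℕ) : ℝ)) ≤ A := by
        have h3 := Real.rpow_add_of_nonneg ha0 (z := ((ℓ - (j + 1) : ℕ) : ℝ) / ((p + 1 : ℕ) : ℝ))
          zero_le_one (by positivity)
        rw [Real.rpow_one] at h3
        rw [← h3]
        refine Real.rpow_le_rpow_of_exponent_ge' ha0 hβ1.le hx0 ?_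
        rw [div_le_iff₀ (by positivity), add_mul, div_mul_cancel₀ _ (by positivity), one_mul]
        exact_mod_cast (by omega : ℓ ≤ (p + 1) + (ℓ - (j + 1)))
      have := mul_le_mul_of_nonneg_left hi ha0
      have h2 := mul_le_mul_of_nonneg_left hpow hM0
      nlinarith
  have hsplit : ∑' j : ℕ, β j * u (k + ℓ - 1 - j) ≤ M * (A + a * (S / (1 - a))) + M * S := by
    rw [← hsum.sum_add_tsum_nat_add p]
    refine add_le_add ?_ ?_
    -- `hwin` bounds `a * u`, so `a = 0` is set apart before dividing.
    · rcases ha0.eq_or_lt with h | h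
      · have hz : ∀ j, β j = 0 := fun j =>
          le_antisymm ((hβ.le_tsum j fun i _ => hβ0 i).trans h.symm.le) (hβ0 j)
        simp only [hz, zero_mul, Finset.sum_const_zero]
        positivity
      · set B := M * (A + a * (S / (1 - a))) with hB
        have hB0 : 0 ≤ B := by positivity
        calc ∑ j ∈ Finset.range p, β j * u (k + ℓ - 1 - j)
            ≤ ∑ j ∈ Finset.range p, β j * (B / a) := by
              refine Finset.sum_le_sum fun j hj => mul_le_mul_of_nonneg_left ?_ (hβ0 j)
              rw [le_div_iff₀ h, mul_comm]
              exact hwin j (Finset.mem_range.1 hj)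
          _ = (∑ j ∈ Finset.range p, β j) * (B / a) := by rw [Finset.sum_mul]
          _ ≤ a * (B / a) := by
              gcongr
              exact hβ.sum_le_tsum _ fun i _ => hβ0 i
          _ = B := by field_simp
    · rw [hS, ← tsum_mul_left]
      refine Summable.tsum_le_tsum (fun j => ?_) ((summable_nat_add_iff p).2 hsum) ?_
      · rw [add_comm p j, mul_comm M]
        exact mul_le_mul_of_nonneg_left (huM _) (hβ0 _)
      · simp_rw [add_comm p]
        exact ((summable_nat_add_iff p).2 hβ).mul_left M
  -- The constant `K = S / (1 - a)` solves `a * K + S = K`, which closes the induction.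
  refine (hrec (k + ℓ) (by omega)).trans (hsplit.trans_eq ?_)
  field_simp
  ring

lemma rate_nonneg {α : ℕ → ℝ} (hα : ∀ k, 1 ≤ k → 0 ≤ α k) (ℓ : ℕ) : 0 ≤ rate α ℓ := by
  refine Real.iInf_nonneg fun p => add_nonneg (Real.rpow_nonneg (tsum_nonneg fun j => ?_) _)
    (tsum_nonneg fun j => hα _ ?_)
  · exact hα _ (by omega)
  · have := p.2.1; omega

lemma rate_le {α : ℕ → ℝ} (hα : ∀ k, 1 ≤ k → 0 ≤ α k) {ℓ p : ℕ} (hp : p ∈ Set.Icc 1 ℓ) :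
    rate α ℓ ≤ (∑' j, α (j + 1)) ^ ((ℓ : ℝ) / p) + ∑' j, α (p + j) := by
  refine ciInf_le (f := fun q : Set.Icc 1 ℓ =>
    (∑' j, α (j + 1)) ^ ((ℓ : ℝ) / ((q : ℕ) : ℝ)) + ∑' j, α ((q : ℕ) + j)) ⟨0, ?_⟩ ⟨p, hp⟩
  rintro _ ⟨q, rfl⟩
  refine add_nonneg (Real.rpow_nonneg (tsum_nonneg fun j => ?_) _) (tsum_nonneg fun j => hα _ ?_)
  · exact hα _ (by omega)
  · have := q.2.1; omega

lemma tendsto_rate {α : ℕ → ℝ} (hα : ∀ k, 1 ≤ k → 0 ≤ α k)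
    (h1 : ∑' j, α (j + 1) < 1) :
    Tendsto (rate α) atTop (𝓝 0) := by
  have ha0 : 0 ≤ ∑' j, α (j + 1) := tsum_nonneg fun j => hα _ (by omega)
  rw [Metric.tendsto_atTop]
  intro ε hε
  -- No summability is needed: tails of a non-summable sequence have `tsum` equal to `0`.
  have htail : Tendsto (fun p => ∑' j, α (p + j)) atTop (𝓝 0) := by
    simpa only [add_comm] using tendsto_sum_nat_add α
  obtain ⟨p, hp, hp1⟩ := ((htail.eventually_lt_const (half_pos hε)).and
    (eventually_ge_atTop 1)).exists
  have hp0 : (0 : ℝ) < p := by exact_mod_cast hp1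
  have hpow : Tendsto (fun ℓ : ℕ => (∑' j, α (j + 1)) ^ ((ℓ : ℝ) / p)) atTop (𝓝 0) :=
    (tendsto_rpow_atTop_of_base_lt_one _ (by linarith) h1).comp
      (tendsto_natCast_atTop_atTop.atTop_div_const hp0)
  obtain ⟨L, hL⟩ := eventually_atTop.1 (hpow.eventually_lt_const (half_pos hε))
  refine ⟨max L p, fun ℓ hℓ => ?_⟩
  rw [Real.dist_eq, sub_zero, abs_of_nonneg (rate_nonneg hα ℓ)]
  have hle : rate α ℓ ≤ (∑' j, α (j + 1)) ^ ((ℓ : ℝ) / p) + ∑' j, α (p + j) :=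
    rate_le hα ⟨hp1, (le_max_right _ _).trans hℓ⟩
  have hlt := hL ℓ ((le_max_left _ _).trans hℓ)
  linarith

end PoissonAR

/-! ### Poisson processes evaluated at independent random times. -/

namespace PoissonAR

/-- The weights satisfy `(n + 1) P{n + 1} = r P{n}`, and the right-hand sides sum to `r`. -/
lemma lintegral_natCast_poissonMeasure (r : ℝ≥0) :
    ∫⁻ n, (n : ℝ≥0∞) ∂(poissonMeasure r) = r := by
  rw [lintegral_countable', tsum_eq_zero_add' ENNReal.summable]
  have hstep : ∀ n : ℕ, ((n + 1 : ℕ) : ℝ≥0∞) * poissonMeasure r {n + 1} =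
      r * poissonMeasure r {n} := by
    intro n
    rw [poissonMeasure_singleton, poissonMeasure_singleton, ← ENNReal.ofReal_natCast,
      ← ENNReal.ofReal_coe_nnreal, ← ENNReal.ofReal_mul (by positivity),
      ← ENNReal.ofReal_mul (by positivity)]
    congr 1
    rw [Nat.factorial_succ]
    push_cast
    have : ((n.factorial : ℕ) : ℝ) ≠ 0 := by positivity
    field_simp
    ring
  have hone : ∑' n, poissonMeasure r {n} = 1 := by
    have := lintegral_countable' (μ := poissonMeasure r) (fun _ => 1)
    simpa using this.symm
  simp only [hstep, Nat.cast_zero, zero_mul, zero_add, ENNReal.tsum_mul_left, hone, mul_one]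

lemma measurable_abs_natCast_sub {Ω : Type*} {m : MeasurableSpace Ω} {f g : Ω → ℕ}
    (hf : Measurable f) (hg : Measurable g) : Measurable fun ω => |(f ω : ℝ) - (g ω : ℝ)| := by
  have hc : Measurable fun n : ℕ => (n : ℝ) := measurable_from_nat
  exact continuous_abs.measurable.comp ((hc.comp hf).sub (hc.comp hg))

lemma IsUnitPoissonProcess.lintegral_abs_sub {Ω : Type*} [MeasurableSpace Ω] {μ : Measure Ω}
    {N : ℝ≥0 → Ω → ℕ} (hN : IsUnitPoissonProcess μ N)
    (a b : ℝ≥0) :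
    ∫⁻ ω, ENNReal.ofReal |(N a ω : ℝ) - (N b ω : ℝ)| ∂μ = ENNReal.ofReal |(a : ℝ) - b| := by
  wlog h : a ≤ b generalizing a b
  · simpa only [abs_sub_comm] using this b a (le_of_not_ge h)
  have hcast : ∀ ω, ENNReal.ofReal |(N a ω : ℝ) - (N b ω : ℝ)| =
      ((N b ω - N a ω : ℕ) : ℝ≥0∞) := by
    intro ω
    rw [abs_sub_comm, ← Nat.cast_sub (hN.mono ω h), Nat.abs_cast, ENNReal.ofReal_natCast]
  have hlaw := hN.increment a b h
  simp_rw [hcast]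
  rw [← lintegral_map' (f := fun n : ℕ => (n : ℝ≥0∞)) Measurable.of_discrete.aemeasurable
    hlaw.aemeasurable, hlaw.map_eq, lintegral_natCast_poissonMeasure, abs_sub_comm,
    ← NNReal.coe_sub h, NNReal.abs_eq, ENNReal.ofReal_coe_nnreal]

/-- Freezing lemma for a discrete random index which is independent of the integrand. -/
lemma lintegral_comp_eq_of_indep {Ω ι : Type*} [Countable ι] [MeasurableSpace ι]
    [MeasurableSingletonClass ι] {m₁ m₂ : MeasurableSpace Ω} {mΩ : MeasurableSpace Ω}
    {μ : Measure Ω} (h₁ : m₁ ≤ mΩ)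
    (h₂ : m₂ ≤ mΩ) (hind : Indep m₁ m₂ μ) {F : ι → Ω → ℝ≥0∞} (hF : ∀ i, Measurable[m₁] (F i))
    {I : Ω → ι} (hI : Measurable[m₂] I) :
    ∫⁻ ω, F (I ω) ω ∂μ = ∫⁻ ω, ∫⁻ ω', F (I ω) ω' ∂μ ∂μ := by
  classical
  have hset : ∀ i, MeasurableSet[m₂] (I ⁻¹' {i}) := fun i => hI (measurableSet_singleton i)
  have hind1 : ∀ i, Measurable[m₂] ((I ⁻¹' {i}).indicator (1 : Ω → ℝ≥0∞)) := fun i =>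
    Measurable.indicator (@measurable_const _ _ _ m₂ _) (hset i)
  -- Splitting over the values of `I` reduces the claim to independence of `F i` and the event `I =
  -- i`.
  have hdecomp : ∀ (G : ι → ℝ≥0∞) (ω : Ω),
      G (I ω) = ∑' i, G i * (I ⁻¹' {i}).indicator (1 : Ω → ℝ≥0∞) ω := by
    intro G ω
    rw [tsum_eq_single (I ω)]
    · simp
    · intro i hi
      simp [Set.indicator, Ne.symm hi]
  calc ∫⁻ ω, F (I ω) ω ∂μ
      = ∫⁻ ω, ∑' i, F i ω * (I ⁻¹' {i}).indicator (1 : Ω → ℝ≥0∞) ω ∂μ :=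
        lintegral_congr fun ω => hdecomp (fun i => F i ω) ω
    _ = ∑' i, (∫⁻ ω', F i ω' ∂μ) * ∫⁻ ω, (I ⁻¹' {i}).indicator (1 : Ω → ℝ≥0∞) ω ∂μ := by
        rw [lintegral_tsum (f := fun i ω => F i ω * (I ⁻¹' {i}).indicator (1 : Ω → ℝ≥0∞) ω)
          fun i => (((hF i).mono h₁ le_rfl).mul ((hind1 i).mono h₂ le_rfl)).aemeasurable]
        exact tsum_congr fun i =>
          lintegral_mul_eq_lintegral_mul_lintegral_of_independent_measurableSpace h₁ h₂ hind
            (hF i) (hind1 i)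
    _ = ∫⁻ ω, ∑' i, (∫⁻ ω', F i ω' ∂μ) * (I ⁻¹' {i}).indicator (1 : Ω → ℝ≥0∞) ω ∂μ := by
        rw [lintegral_tsum fun i => (((hind1 i).mono h₂ le_rfl).const_mul _).aemeasurable]
        exact tsum_congr fun i => (lintegral_const_mul _ ((hind1 i).mono h₂ le_rfl)).symm
    _ = _ := lintegral_congr fun ω => (hdecomp (fun i => ∫⁻ ω', F i ω' ∂μ) ω).symm

/-- The approximation of `x` from above in the grid of mesh `1 / (n + 1)`. -/
noncomputable def ceilGrid (n : ℕ) (x : ℝ≥0) : ℝ≥0 := ⌈(n + 1 : ℝ≥0) * x⌉₊ / (n + 1 : ℝ≥0)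

lemma le_ceilGrid (n : ℕ) (x : ℝ≥0) : x ≤ ceilGrid n x := by
  rw [ceilGrid, le_div_iff₀ (by positivity), mul_comm]
  exact Nat.le_ceil _

lemma ceilGrid_le (n : ℕ) (x : ℝ≥0) : ceilGrid n x ≤ x + 1 / (n + 1 : ℝ≥0) := by
  have h0 : (0 : ℝ≥0) < n + 1 := by positivity
  have h1 : (x + 1 / (n + 1 : ℝ≥0)) * (n + 1) = (n + 1) * x + 1 := by field_simp
  rw [ceilGrid, div_le_iff₀ h0, h1]
  exact (Nat.ceil_lt_add_one (by positivity)).le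

/-- Rounding up, not down, is what right-continuity of the paths requires. -/
lemma tendsto_ceilGrid (x : ℝ≥0) : Tendsto (fun n => ceilGrid n x) atTop (𝓝[≥] x) := by
  refine tendsto_nhdsWithin_iff.2 ⟨?_, .of_forall fun n => le_ceilGrid n x⟩
  refine tendsto_of_tendsto_of_tendsto_of_le_of_le tendsto_const_nhds ?_
    (fun n => le_ceilGrid n x) (fun n => ceilGrid_le n x)
  simpa using (tendsto_const_nhds (x := x)).add (tendsto_one_div_add_atTop_nhds_zero_nat (𝕜 := ℝ≥0))

lemma abs_ceilGrid_sub_le (n : ℕ) (x y : ℝ≥0) :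
    |(ceilGrid n x : ℝ) - ceilGrid n y| ≤ |(x : ℝ) - y| + 1 / (n + 1 : ℝ) := by
  have h1 : (x : ℝ) ≤ ceilGrid n x := le_ceilGrid n x
  have h2 : (y : ℝ) ≤ ceilGrid n y := le_ceilGrid n y
  have h3 : (ceilGrid n x : ℝ) ≤ x + 1 / (n + 1 : ℝ) := by exact_mod_cast ceilGrid_le n x
  have h4 : (ceilGrid n y : ℝ) ≤ y + 1 / (n + 1 : ℝ) := by exact_mod_cast ceilGrid_le n y
  rw [abs_le]
  constructor <;> [have := neg_abs_le ((x : ℝ) - y); have := le_abs_self ((x : ℝ) - y)] <;> linarith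

lemma measurable_comp_of_countable {Ω ι β : Type*} [MeasurableSpace Ω] [MeasurableSpace β]
    [Countable ι] [MeasurableSpace ι] [MeasurableSingletonClass ι] {F : ι → Ω → β}
    (hF : ∀ i, Measurable (F i)) {I : Ω → ι} (hI : Measurable I) :
    Measurable fun ω => F (I ω) ω :=
  (measurable_from_prod_countable_right (f := fun z : ι × Ω => F z.1 z.2) hF).comp
    (hI.prodMk measurable_id)

lemma measurable_comp_ceilGrid {Ω : Type*} [MeasurableSpace Ω] {N : ℝ≥0 → Ω → ℕ}
    (hN : ∀ u, Measurable (N u)) (n : ℕ) {X : Ω → ℝ≥0} (hX : Measurable X) :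
    Measurable fun ω => N (ceilGrid n (X ω)) ω := by
  have hI : Measurable fun ω => ⌈(n + 1 : ℝ≥0) * X ω⌉₊ :=
    Nat.measurable_ceil.comp (hX.const_mul _)
  have hF : ∀ i : ℕ, Measurable (N (i / (n + 1 : ℝ≥0))) := fun i => hN _
  have h := measurable_comp_of_countable hF hI
  simpa only [ceilGrid] using h

/-- Grid times take countably many values, so the pair of them can be frozen. Both rounding errors
lie in `[0, 1 / (n + 1)]`, hence their difference costs `1 / (n + 1)` only once. -/
lemma IsUnitPoissonProcess.lintegral_abs_sub_comp_ceilGrid_le {Ω : Type*}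
    {m₁ m mΩ : MeasurableSpace Ω} {μ : Measure Ω} [IsProbabilityMeasure μ]
    {N : ℝ≥0 → Ω → ℕ} (hN : IsUnitPoissonProcess μ N) (h₁ : m₁ ≤ mΩ) (hm : m ≤ mΩ)
    (hNu : ∀ u, Measurable[m₁] (N u)) (hind : Indep m₁ m μ)
    {X X' : Ω → ℝ≥0} (hX : Measurable[m] X) (hX' : Measurable[m] X') (n : ℕ) :
    ∫⁻ ω, ENNReal.ofReal |(N (ceilGrid n (X ω)) ω : ℝ) - (N (ceilGrid n (X' ω)) ω : ℝ)| ∂μ ≤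
      ∫⁻ ω, ENNReal.ofReal |(X ω : ℝ) - (X' ω : ℝ)| ∂μ + ENNReal.ofReal (1 / (n + 1 : ℝ)) := by
  have hF : ∀ i : ℕ × ℕ, Measurable[m₁] fun ω => ENNReal.ofReal
      |(N (i.1 / (n + 1 : ℝ≥0)) ω : ℝ) - (N (i.2 / (n + 1 : ℝ≥0)) ω : ℝ)| := fun i =>
    ENNReal.measurable_ofReal.comp (measurable_abs_natCast_sub (hNu _) (hNu _))
  have hI : Measurable[m] fun ω => (⌈(n + 1 : ℝ≥0) * X ω⌉₊, ⌈(n + 1 : ℝ≥0) * X' ω⌉₊) :=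
    (Nat.measurable_ceil.comp (hX.const_mul _)).prodMk (Nat.measurable_ceil.comp (hX'.const_mul _))
  refine (lintegral_comp_eq_of_indep h₁ hm hind hF hI).trans_le ?_
  calc _ ≤ ∫⁻ ω, (ENNReal.ofReal |(X ω : ℝ) - (X' ω : ℝ)| +
          ENNReal.ofReal (1 / (n + 1 : ℝ))) ∂μ := by
        refine lintegral_mono fun ω => ?_
        refine (hN.lintegral_abs_sub (ceilGrid n (X ω)) (ceilGrid n (X' ω))).trans_le ?_
        rw [← ENNReal.ofReal_add (abs_nonneg _) (by positivity)]
        exact ENNReal.ofReal_le_ofReal (abs_ceilGrid_sub_le n (X ω) (X' ω))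
    _ = _ := by
        rw [lintegral_add_right _ measurable_const, lintegral_const, measure_univ, mul_one]

/-- Evaluating a unit-rate Poisson process at two independent random times does not increase
their `L¹` distance. -/
lemma IsUnitPoissonProcess.lintegral_abs_sub_comp_le {Ω : Type*}
    {m₁ m mΩ : MeasurableSpace Ω} {μ : Measure Ω} [IsProbabilityMeasure μ]
    {N : ℝ≥0 → Ω → ℕ} (hN : IsUnitPoissonProcess μ N) (h₁ : m₁ ≤ mΩ) (hm : m ≤ mΩ)
    (hNu : ∀ u, Measurable[m₁] (N u)) (hind : Indep m₁ m μ)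
    {X X' : Ω → ℝ≥0} (hX : Measurable[m] X) (hX' : Measurable[m] X') :
    ∫⁻ ω, ENNReal.ofReal |(N (X ω) ω : ℝ) - (N (X' ω) ω : ℝ)| ∂μ ≤
      ∫⁻ ω, ENNReal.ofReal |(X ω : ℝ) - (X' ω : ℝ)| ∂μ := by
  set D : ℕ → Ω → ℝ≥0∞ := fun n ω =>
    ENNReal.ofReal |(N (ceilGrid n (X ω)) ω : ℝ) - (N (ceilGrid n (X' ω)) ω : ℝ)| with hD
  have hlim : ∀ ω, Tendsto (fun n => D n ω) atTop
      (𝓝 (ENNReal.ofReal |(N (X ω) ω : ℝ) - (N (X' ω) ω : ℝ)|)) := by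
    intro ω
    have hc : ∀ x : ℝ≥0, Tendsto (fun n => (N (ceilGrid n x) ω : ℝ)) atTop (𝓝 (N x ω : ℝ)) := by
      intro x
      have h1 : Tendsto (fun n => N (ceilGrid n x) ω) atTop (𝓝 (N x ω)) :=
        (hN.rightCts ω x).tendsto.comp (tendsto_ceilGrid x)
      exact (continuous_of_discreteTopology (f := fun i : ℕ => (i : ℝ))).continuousAt.tendsto.comp h1
    exact ENNReal.tendsto_ofReal ((hc (X ω)).sub (hc (X' ω))).abs
  have hmeas : ∀ n, Measurable (D n) := fun n =>
    ENNReal.measurable_ofReal.comp (measurable_abs_natCast_sub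
      (measurable_comp_ceilGrid hN.measurable n (hX.mono hm le_rfl))
      (measurable_comp_ceilGrid hN.measurable n (hX'.mono hm le_rfl)))
  have hbound : Tendsto (fun n : ℕ => ∫⁻ ω, ENNReal.ofReal |(X ω : ℝ) - (X' ω : ℝ)| ∂μ +
      ENNReal.ofReal (1 / (n + 1 : ℝ))) atTop
      (𝓝 (∫⁻ ω, ENNReal.ofReal |(X ω : ℝ) - (X' ω : ℝ)| ∂μ)) := by
    have h0 := ENNReal.tendsto_ofReal (tendsto_one_div_add_atTop_nhds_zero_nat (𝕜 := ℝ))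
    rw [ENNReal.ofReal_zero] at h0
    simpa only [add_zero] using h0.const_add (∫⁻ ω, ENNReal.ofReal |(X ω : ℝ) - (X' ω : ℝ)| ∂μ)
  -- Fatou's lemma along the grids.
  calc _ = ∫⁻ ω, liminf (fun n => D n ω) atTop ∂μ :=
        lintegral_congr fun ω => (hlim ω).liminf_eq.symm
    _ ≤ liminf (fun n => ∫⁻ ω, D n ω ∂μ) atTop := lintegral_liminf_le hmeas
    _ ≤ _ := (liminf_le_liminf (.of_forall fun n =>
        hN.lintegral_abs_sub_comp_ceilGrid_le h₁ hm hNu hind hX hX' n)).trans_eq hbound.liminf_eq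

/-! ### The recursion for the `L¹` distance and its a priori bound. -/

lemma measurable_pastSigma {Ω : Type*} (X : ℤ → Ω → ℕ) {s t : ℤ} (h : s ≤ t) :
    Measurable[pastSigma X t] (X s) :=
  Measurable.of_comap_le (le_iSup₂_of_le s h le_rfl)

lemma measurable_lags {Ω : Type*} (X : ℤ → Ω → ℕ) (t : ℤ) :
    Measurable[pastSigma X (t - 1)] (lags X t) :=
  @measurable_pi_lambda _ _ _ (pastSigma X (t - 1)) _ _ fun j =>
    (Measurable.of_discrete (f := fun n : ℕ => (n : ℝ≥0))).comp
      (measurable_pastSigma X (by omega))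

variable {Ω : Type*} [mΩ : MeasurableSpace Ω] {μ : Measure Ω}

lemma pastSigma_le {X : ℤ → Ω → ℕ} (hX : ∀ t, Measurable (X t)) (t : ℤ) :
    pastSigma X t ≤ mΩ :=
  iSup₂_le fun s _ => (hX s).comap_le

/-- The `L¹` distance of the two coupled processes at time `t`, as an extended real. -/
noncomputable def gap (μ : Measure Ω) (Y Y' : ℤ → Ω → ℕ) (t : ℤ) : ℝ≥0∞ :=
  ∫⁻ ω, ENNReal.ofReal |(Y t ω : ℝ) - (Y' t ω : ℝ)| ∂μ

lemma measurable_ofReal_abs_sub {Y Y' : ℤ → Ω → ℕ} (hY : ∀ t, Measurable (Y t))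
    (hY' : ∀ t, Measurable (Y' t)) (t : ℤ) :
    Measurable fun ω => ENNReal.ofReal |(Y t ω : ℝ) - (Y' t ω : ℝ)| :=
  ENNReal.measurable_ofReal.comp (measurable_abs_natCast_sub (hY t) (hY' t))

lemma IsPoissonCoupling.gap_le [IsProbabilityMeasure μ] {g : (ℕ → ℝ≥0) → ℝ≥0} {k : ℤ}
    {N : ℤ → ℝ≥0 → Ω → ℕ} {Y Y' : ℤ → Ω → ℕ} (hN : IsPoissonCoupling μ g k N Y Y')
    (hg : Measurable g) (hY : ∀ t, Measurable (Y t)) (hY' : ∀ t, Measurable (Y' t))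
    {β : ℕ → ℝ} (hβ : ∀ j, 0 ≤ β j)
    (hLip : ∀ y y' : ℕ → ℝ≥0, ENNReal.ofReal |(g y : ℝ) - (g y' : ℝ)| ≤
      ∑' j, ENNReal.ofReal (β j * |(y j : ℝ) - (y' j : ℝ)|)) {t : ℤ} (ht : k < t) :
    gap μ Y Y' t ≤ ∑' j : ℕ, ENNReal.ofReal (β j) * gap μ Y Y' (t - 1 - j) := by
  have hX : Measurable[pastSigma Y (t - 1) ⊔ pastSigma Y' (t - 1)] fun ω => g (lags Y t ω) :=
    (hg.comp (measurable_lags Y t)).mono le_sup_left le_rfl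
  have hX' : Measurable[pastSigma Y (t - 1) ⊔ pastSigma Y' (t - 1)] fun ω => g (lags Y' t ω) :=
    (hg.comp (measurable_lags Y' t)).mono le_sup_right le_rfl
  calc gap μ Y Y' t
      = ∫⁻ ω, ENNReal.ofReal |(N t (g (lags Y t ω)) ω : ℝ) - (N t (g (lags Y' t ω)) ω : ℝ)| ∂μ := by
        refine lintegral_congr_ae ?_
        filter_upwards [hN.eq_left t ht, hN.eq_right t ht] with ω h h'
        rw [← h, ← h']
    _ ≤ ∫⁻ ω, ENNReal.ofReal |(g (lags Y t ω) : ℝ) - (g (lags Y' t ω) : ℝ)| ∂μ :=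
        (hN.poisson t ht).lintegral_abs_sub_comp_le
          (measurable_pi_lambda _ fun u => (hN.poisson t ht).measurable u).comap_le
          (sup_le (pastSigma_le hY (t - 1)) (pastSigma_le hY' (t - 1)))
          (fun u => (measurable_pi_apply u).comp
            (comap_measurable (fun (ω : Ω) (u : ℝ≥0) => N t u ω)))
          (hN.indep_past t ht) hX hX'
    _ ≤ ∫⁻ ω, ∑' j : ℕ, ENNReal.ofReal (β j) *
          ENNReal.ofReal |(Y (t - 1 - j) ω : ℝ) - (Y' (t - 1 - j) ω : ℝ)| ∂μ := by
        refine lintegral_mono fun ω => (hLip _ _).trans_eq (tsum_congr fun j => ?_)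
        rw [ENNReal.ofReal_mul (hβ j)]
        simp [lags]
    _ = _ := by
        rw [lintegral_tsum fun j =>
          ((measurable_ofReal_abs_sub hY hY' _).const_mul _).aemeasurable]
        exact tsum_congr fun j => lintegral_const_mul _ (measurable_ofReal_abs_sub hY hY' _)

lemma gap_le_add {Y Y' : ℤ → Ω → ℕ} (hY : ∀ t, Measurable (Y t)) (t : ℤ) :
    gap μ Y Y' t ≤ ∫⁻ ω, (Y t ω : ℝ≥0∞) ∂μ + ∫⁻ ω, (Y' t ω : ℝ≥0∞) ∂μ := by
  have hm : Measurable fun ω => (Y t ω : ℝ≥0∞) :=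
    (Measurable.of_discrete (f := fun n : ℕ => (n : ℝ≥0∞))).comp (hY t)
  rw [← lintegral_add_left hm]
  refine lintegral_mono fun ω => ?_
  rw [← ENNReal.ofReal_natCast, ← ENNReal.ofReal_natCast (Y' t ω),
    ← ENNReal.ofReal_add (by positivity) (by positivity)]
  refine ENNReal.ofReal_le_ofReal ((abs_sub _ _).trans_eq ?_)
  rw [Nat.abs_cast, Nat.abs_cast]

lemma IsStationaryRegime.lintegral_eq {g : (ℕ → ℝ≥0) → ℝ≥0} {Y : ℤ → Ω → ℕ}
    (hY : IsStationaryRegime μ g Y) (t : ℤ) :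
    ∫⁻ ω, (Y t ω : ℝ≥0∞) ∂μ = ∫⁻ ω, (Y 0 ω : ℝ≥0∞) ∂μ := by
  have hφ : Measurable fun x : ℤ → ℕ => (x 0 : ℝ≥0∞) :=
    (Measurable.of_discrete (f := fun n : ℕ => (n : ℝ≥0∞))).comp (measurable_pi_apply 0)
  have h := congrArg (fun ν => ∫⁻ x, (x 0 : ℝ≥0∞) ∂ν) (hY.stationary t)
  rw [lintegral_map hφ (measurable_pi_lambda _ fun s => hY.measurable _),
    lintegral_map hφ (measurable_pi_lambda _ fun s => hY.measurable _)] at h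
  simpa using h

/-- Stated in `ℝ≥0∞` because it is what shows that the distances after time `k` are finite; only
then can the recursion be read in `ℝ`. -/
lemma le_of_le_tsum_past_of_le {u : ℤ → ℝ≥0∞} {M : ℝ≥0∞} {β : ℕ → ℝ≥0∞} {k : ℤ}
    (hβ : ∑' j, β j ≤ 1) (hM : ∀ t ≤ k, u t ≤ M)
    (hrec : ∀ t, k < t → u t ≤ ∑' j : ℕ, β j * u (t - 1 - j)) (t : ℤ) : u t ≤ M := by
  rcases le_or_gt t k with h | h
  · exact hM t h
  obtain ⟨ℓ, rfl⟩ : ∃ ℓ : ℕ, t = k + ℓ := ⟨(t - k).toNat, by omega⟩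
  induction ℓ using Nat.strong_induction_on with
  | _ ℓ ih =>
  calc u (k + ℓ) ≤ ∑' j : ℕ, β j * u (k + ℓ - 1 - j) := hrec _ h
    _ ≤ ∑' j : ℕ, β j * M := by
        refine ENNReal.tsum_le_tsum fun j => mul_le_mul_right ?_ _
        rcases le_or_gt (k + ℓ - 1 - j : ℤ) k with h' | h'
        · exact hM _ h'
        · have heq : (k + ℓ - 1 - j : ℤ) = k + ((ℓ - 1 - j : ℕ) : ℤ) := by omega
          rw [heq]
          exact ih _ (by omega) (by omega)
    _ ≤ M := by
        rw [ENNReal.tsum_mul_right]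
        exact mul_le_of_le_one_left' hβ

end PoissonAR

theorem lemma7p1 {Ω : Type*} [MeasurableSpace Ω] (μ : Measure Ω) [IsProbabilityMeasure μ]
    {d : ℕ} (Θ : Set (EuclideanSpace ℝ (Fin d))) (hΘ : IsCompact Θ)
    (f : EuclideanSpace ℝ (Fin d) → (ℕ → ℝ≥0) → ℝ≥0)
    (hf_meas : ∀ θ ∈ Θ, Measurable (f θ))
    (hf_smooth : ∀ y, ContDiffOn ℝ 2 (fun θ => (f θ y : ℝ)) Θ)
    (θs : EuclideanSpace ℝ (Fin d)) (hθs : θs ∈ interior Θ)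
    (k : ℤ) (Y Y' : ℤ → Ω → ℕ) (N : ℤ → ℝ≥0 → Ω → ℕ)
    (hY : PoissonAR.IsPoissonARAfter μ (f θs) k Y)
    (hY' : PoissonAR.IsStationaryRegime μ (f θs) Y')
    (hN : PoissonAR.IsPoissonCoupling μ (f θs) k N Y Y')
    (α : ℕ → ℝ) (hA : PoissonAR.LipschitzCond Θ f α)
    (γ : ℝ) (hγ : 3 / 2 < γ)
    (hα : (fun j : ℕ => α j) =O[atTop] fun j : ℕ => (j : ℝ) ^ (-γ))
    (hD : PoissonAR.LowerBoundCond Θ f)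
    (hId : PoissonAR.IdentifiabilityCond μ Θ f k Y)
    (hmom : PoissonAR.PastMomentCond μ k Y) :
    (∃ C : ℝ, 0 < C ∧ ∀ ℓ : ℕ, 1 ≤ ℓ →
      Integrable (fun ω => |(Y (k + ℓ) ω : ℝ) - (Y' (k + ℓ) ω : ℝ)|) μ ∧
      ∫ ω, |(Y (k + ℓ) ω : ℝ) - (Y' (k + ℓ) ω : ℝ)| ∂μ ≤ C * PoissonAR.rate α ℓ) ∧
    Tendsto (fun ℓ : ℕ => PoissonAR.rate α ℓ) atTop (𝓝 0) ∧
    Tendsto (fun ℓ : ℕ => ∫ ω, |(Y (k + ℓ) ω : ℝ) - (Y' (k + ℓ) ω : ℝ)| ∂μ) atTop (𝓝 0) := by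
  have hθ : θs ∈ Θ := interior_subset hθs
  set β : ℕ → ℝ := fun j => α (j + 1) with hβ
  have hβ0 : ∀ j, 0 ≤ β j := fun j => hA.nonneg _ (by omega)
  have hrec : ∀ t, k < t → PoissonAR.gap μ Y Y' t ≤
      ∑' j : ℕ, ENNReal.ofReal (β j) * PoissonAR.gap μ Y Y' (t - 1 - j) := fun t ht =>
    hN.gap_le (hf_meas θs hθ) hY.measurable hY'.measurable hβ0 (hA.lipschitz θs hθ) ht
  obtain ⟨C₀, hC₀, hYC⟩ := hmom 1 le_rfl
  obtain ⟨C₁, hC₁⟩ : ∃ C₁ : ℝ≥0, ∫⁻ ω, (Y' 0 ω : ℝ≥0∞) ∂μ = C₁ := by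
    have := hY'.moments 1 le_rfl 0
    simp only [ENNReal.rpow_one] at this
    exact ⟨_, (ENNReal.coe_toNNReal this.ne).symm⟩
  simp only [ENNReal.rpow_one] at hYC
  have hgM : ∀ t, PoissonAR.gap μ Y Y' t ≤ ((C₀ + C₁ : ℝ≥0) : ℝ≥0∞) := by
    refine PoissonAR.le_of_le_tsum_past_of_le (β := fun j => ENNReal.ofReal (β j)) (k := k)
      ?_ (fun t ht => ?_) hrec
    · rw [← ENNReal.ofReal_tsum_of_nonneg hβ0 hA.summable]
      exact ENNReal.ofReal_le_one.2 hA.sum_lt_one.le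
    · rw [ENNReal.coe_add]
      refine (PoissonAR.gap_le_add hY.measurable t).trans (add_le_add (hYC t ht) ?_)
      rw [hY'.lintegral_eq, hC₁]
  have hgt : ∀ t, PoissonAR.gap μ Y Y' t ≠ ∞ := fun t =>
    ne_top_of_le_ne_top ENNReal.coe_ne_top (hgM t)
  set u : ℤ → ℝ := fun t => (PoissonAR.gap μ Y Y' t).toReal with hu
  have hu0 : ∀ t, 0 ≤ u t := fun t => ENNReal.toReal_nonneg
  have huM : ∀ t, u t ≤ ((C₀ + C₁ : ℝ≥0) : ℝ) := fun t =>
    ENNReal.toReal_le_coe_of_le_coe (hgM t)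
  have hurec : ∀ t, k < t → u t ≤ ∑' j : ℕ, β j * u (t - 1 - j) := by
    intro t ht
    have hs : Summable fun j : ℕ => β j * u (t - 1 - j) :=
      .of_nonneg_of_le (fun j => mul_nonneg (hβ0 j) (hu0 _))
        (fun j => mul_le_mul_of_nonneg_left (huM _) (hβ0 j)) (hA.summable.mul_right _)
    refine ENNReal.toReal_le_of_le_ofReal (tsum_nonneg fun j => mul_nonneg (hβ0 j) (hu0 _)) ?_
    rw [ENNReal.ofReal_tsum_of_nonneg (fun j => mul_nonneg (hβ0 j) (hu0 _)) hs]
    refine (hrec t ht).trans_eq (tsum_congr fun j => ?_)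
    rw [ENNReal.ofReal_mul (hβ0 j), ENNReal.ofReal_toReal (hgt _)]
  have hmeas : ∀ t, Measurable fun ω => |(Y t ω : ℝ) - (Y' t ω : ℝ)| := fun t =>
    PoissonAR.measurable_abs_natCast_sub (hY.measurable t) (hY'.measurable t)
  have hint : ∀ t, Integrable (fun ω => |(Y t ω : ℝ) - (Y' t ω : ℝ)|) μ := fun t =>
    (lintegral_ofReal_ne_top_iff_integrable (hmeas t).aestronglyMeasurable
      (.of_forall fun ω => abs_nonneg _)).1 (hgt t)
  have hueq : ∀ t, ∫ ω, |(Y t ω : ℝ) - (Y' t ω : ℝ)| ∂μ = u t := fun t =>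
    integral_eq_lintegral_of_nonneg_ae (.of_forall fun ω => abs_nonneg _)
      (hmeas t).aestronglyMeasurable
  set a := ∑' j, β j with ha
  have ha0 : 0 ≤ a := tsum_nonneg hβ0
  have ha1 : a < 1 := hA.sum_lt_one
  have hM : (0 : ℝ) < ((C₀ + C₁ : ℝ≥0) : ℝ) := by positivity
  have h1a : 0 < 1 - a := by linarith
  have hrate := PoissonAR.tendsto_rate hA.nonneg hA.sum_lt_one
  have hbound : ∀ ℓ : ℕ, 1 ≤ ℓ →
      u (k + ℓ) ≤ ((C₀ + C₁ : ℝ≥0) : ℝ) / (1 - a) * PoissonAR.rate α ℓ := by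
    intro ℓ hℓ
    have : Nonempty (Set.Icc 1 ℓ) := ⟨⟨1, le_rfl, hℓ⟩⟩
    rw [PoissonAR.rate, Real.mul_iInf_of_nonneg (by positivity)]
    refine le_ciInf fun ⟨p, hp1, hpℓ⟩ => ?_
    -- Since `β j = α (j + 1)`, a tail of `α` from `p = q + 1` is a tail of `β` from `q`.
    obtain ⟨q, rfl⟩ : ∃ q, p = q + 1 := ⟨p - 1, by omega⟩
    have h := PoissonAR.le_of_le_tsum_past hu0 huM hβ0 hA.summable hA.sum_lt_one hurec q ℓ
    have htail : ∑' j, α (q + 1 + j) = ∑' j, β (q + j) :=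
      tsum_congr fun j => by rw [hβ]; congr 1; omega
    simp only [htail]
    have hA0 : 0 ≤ a ^ ((ℓ : ℝ) / ((q + 1 : ℕ) : ℝ)) := Real.rpow_nonneg ha0 _
    refine h.trans ?_
    rw [div_mul_eq_mul_div, mul_div_assoc, add_div]
    gcongr
    -- The power term needs no factor `1 / (1 - a) ≥ 1`; it is enlarged to share the constant of the
    -- tail.
    rw [le_div_iff₀ h1a]
    exact mul_le_of_le_one_right hA0 (by linarith)
  refine ⟨⟨((C₀ + C₁ : ℝ≥0) : ℝ) / (1 - a), by positivity, fun ℓ hℓ =>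
    ⟨hint _, (hueq _).trans_le (hbound ℓ hℓ)⟩⟩, hrate, ?_⟩
  simp_rw [hueq]
  refine tendsto_of_tendsto_of_tendsto_of_le_of_le' tendsto_const_nhds
    (by simpa using hrate.const_mul (((C₀ + C₁ : ℝ≥0) : ℝ) / (1 - a)))
    (.of_forall fun ℓ => hu0 _) ?_
  filter_upwards [eventually_ge_atTop 1] with ℓ hℓ using hbound ℓ hℓ
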